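/- Let $\mathbb F$ be an algebraically closed field and let $q\in\mathbb F$ be nonzero and not a root of unity. The universal Askey--Wilson algebra $\triangle_q$ is the unital associative $\mathbb F$-algebra generated by $A,B,C$ subject to the relations that each of $$A+\frac{qBC-q^{-1}CB}{q^2-q^{-2}},\qquad B+\frac{qCA-q^{-1}AC}{q^2-q^{-2}},\qquad C+\frac{qAB-q^{-1}BA}{q^2-q^{-2}}$$ commutes with $A,B,C$. The universal DAHA $\mathfrak H_q$ of type $(C_1^\vee,C_1)$ is the unital associative $\mathbb F$-algebra generated by $t_i^{\pm1}$ ($i=0,1,2,3$) subject to the relations $t_it_i^{-1}=t_i^{-1}t_i=1$, $t_i+t_i^{-1}$ is central ($i=0,1,2,3$), and $t_0t_1t_2t_3=q^{-1}$. Every $\mathfrak H_q$-module is regarded as a $\triangle_q$-module via the algebra homomorphism $\zeta:\triangle_q\to\mathfrak H_q$ with $$A\mapsto t_1t_0+(t_1t_0)^{-1},\qquad B\mapsto t_3t_0+(t_3t_0)^{-1},\qquad C\mapsto t_2t_0+(t_2t_0)^{-1}.$$ Let $d\ge 1$ be an odd integer and let $k_0,k_1,k_2,k_3\in\mathbb F$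 be nonzero with $k_0^2=q^{-d-1}$. Let $E=E(k_0,k_1,k_2,k_3)$ be the $(d+1)$-dimensional $\mathfrak H_q$-module with $\mathbb F$-basis $v_0,\dots,v_d$ on which $t_i+t_i^{-1}$ acts as the scalar $k_i+k_i^{-1}$ ($i=0,1,2,3$) and \begin{align*} t_0v_i&=k_0^{-1}q^{-i}(1-q^i)(1-k_0^2q^i)v_{i-1}+(k_0+k_0^{-1}-k_0^{-1}q^{-i})v_i && (i=2,4,\dots,d-1),\\ t_0v_i&=k_0^{-1}q^{-i-1}(v_i-v_{i+1}) && (i=1,3,\dots,d-2),\\ t_0v_0&=k_0v_0,\qquad t_0v_d=k_0v_d,\\ t_1v_i&=-k_1(1-q^i)(1-k_0^2q^i)v_{i-1}+k_1v_i+k_1^{-1}v_{i+1} && (i=2,4,\dots,d-1),\\ t_1v_i&=k_1^{-1}v_i && (i=1,3,\dots,d),\\ t_1v_0&=k_1v_0+k_1^{-1}v_1,\\ t_2v_i&=k_0^{-1}k_1^{-1}k_3^{-1}q^{-i-1}(v_i-v_{i+1}) && (i=0,2,\dots,d-1),\\ t_2v_i&=\frac{(k_0k_1k_3q^i-k_2)(k_0k_1k_3q^i-k_2^{-1})}{k_0k_1k_3q^i}v_{i-1}+(k_2+k_2^{-1}-k_0^{-1}k_1^{-1}k_3^{-1}q^{-i})v_i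 && (i=1,3,\dots,d),\\ t_3v_i&=k_3v_i && (i=0,2,\dots,d-1),\\ t_3v_i&=-k_3^{-1}(k_0k_1k_3q^i-k_2)(k_0k_1k_3q^i-k_2^{-1})v_{i-1}+k_3^{-1}v_i+k_3v_{i+1} && (i=1,3,\dots,d-2),\\ t_3v_d&=-k_3^{-1}(k_0k_1k_3q^d-k_2)(k_0k_1k_3q^d-k_2^{-1})v_{d-1}+k_3^{-1}v_d. \end{align*} For $\theta\in\mathbb F$ put $E(\theta)=\{v\in E\mid t_0v=\theta v\}$, which is a $\triangle_q$-submodule of $E$. Assume that the $\mathfrak H_q$-module $E$ is irreducible. Then: (i) If $d=1$, the $\triangle_q$-module $E$ is irreducible. (ii) If $d\ge 3$, the lattice of $\triangle_q$-submodules of $E$ is the diamond: its elements are exactly the four distinct submodules $\{0\}$, $E(k_0)$, $E(k_0^{-1})$, $E$, where $E(k_0)$ and $E(k_0^{-1})$ are incomparable and lie strictly between $\{0\}$ and $E$. -/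

import Mathlib

/-!
The universal Askey–Wilson algebra, the universal DAHA of type `(C₁^∨, C₁)`, the homomorphism
between them, the even-dimensional modules `E(k₀,k₁,k₂,k₃)` and the eigenspaces of `t₀`.
-/

namespace DahaAW

/-! ### Presentations of the two algebras -/

/-- The formal generators `A, B, C`. -/
inductive AWGen : Type
  | A | B | C

/-- The elements `A + (q BC - q⁻¹ CB)/(q² - q⁻²)` and its two cyclic companions, for three
elements of an `F`-algebra: apply to `(A,B,C)`, `(B,C,A)`, `(C,A,B)`. -/
def awElt {F R : Type*} [Field F] [Ring R] [Algebra F R] (q : F) (a b c : R) : R :=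
  a + (q ^ 2 - q⁻¹ ^ 2)⁻¹ • (q • (b * c) - q⁻¹ • (c * b))

/-- The defining relations of `△_q`. -/
inductive AWRel {F : Type*} [Field F] (q : F) :
    FreeAlgebra F AWGen → FreeAlgebra F AWGen → Prop
  | commA (g : AWGen) : AWRel q
      (awElt q (FreeAlgebra.ι F .A) (FreeAlgebra.ι F .B) (FreeAlgebra.ι F .C) *
        FreeAlgebra.ι F g)
      (FreeAlgebra.ι F g *
        awElt q (FreeAlgebra.ι F .A) (FreeAlgebra.ι F .B) (FreeAlgebra.ι F .C))
  | commB (g : AWGen) : AWRel q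
      (awElt q (FreeAlgebra.ι F .B) (FreeAlgebra.ι F .C) (FreeAlgebra.ι F .A) *
        FreeAlgebra.ι F g)
      (FreeAlgebra.ι F g *
        awElt q (FreeAlgebra.ι F .B) (FreeAlgebra.ι F .C) (FreeAlgebra.ι F .A))
  | commC (g : AWGen) : AWRel q
      (awElt q (FreeAlgebra.ι F .C) (FreeAlgebra.ι F .A) (FreeAlgebra.ι F .B) *
        FreeAlgebra.ι F g)
      (FreeAlgebra.ι F g *
        awElt q (FreeAlgebra.ι F .C) (FreeAlgebra.ι F .A) (FreeAlgebra.ι F .B))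

/-- The universal Askey–Wilson algebra `△_q`. -/
abbrev AW {F : Type*} [Field F] (q : F) : Type _ := RingQuot (AWRel q)

/-- The formal generators `tᵢ` and `tᵢ⁻¹`, `i = 0,1,2,3`. -/
inductive DAHAGen : Type
  | t (i : Fin 4)
  | tinv (i : Fin 4)

/-- The defining relations of `ℌ_q`. -/
inductive DAHARel {F : Type*} [Field F] (q : F) :
    FreeAlgebra F DAHAGen → FreeAlgebra F DAHAGen → Prop
  | mul_inv (i : Fin 4) : DAHARel q
      (FreeAlgebra.ι F (.t i) * FreeAlgebra.ι F (.tinv i)) 1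
  | inv_mul (i : Fin 4) : DAHARel q
      (FreeAlgebra.ι F (.tinv i) * FreeAlgebra.ι F (.t i)) 1
  | central (i : Fin 4) (x : FreeAlgebra F DAHAGen) : DAHARel q
      ((FreeAlgebra.ι F (.t i) + FreeAlgebra.ι F (.tinv i)) * x)
      (x * (FreeAlgebra.ι F (.t i) + FreeAlgebra.ι F (.tinv i)))
  | prod : DAHARel q
      (FreeAlgebra.ι F (.t 0) * FreeAlgebra.ι F (.t 1) * FreeAlgebra.ι F (.t 2) *
        FreeAlgebra.ι F (.t 3))
      (algebraMap F _ q⁻¹)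

/-- The universal double affine Hecke algebra `ℌ_q` of type `(C₁^∨, C₁)`. -/
abbrev DAHA {F : Type*} [Field F] (q : F) : Type _ := RingQuot (DAHARel q)

section Algebras

variable {F : Type*} [Field F] (q : F)

/-- The element `tᵢ` of `ℌ_q`. -/
noncomputable def t (i : Fin 4) : DAHA q :=
  RingQuot.mkAlgHom F (DAHARel q) (FreeAlgebra.ι F (.t i))

/-- The element `tᵢ⁻¹` of `ℌ_q`. -/
noncomputable def tinv (i : Fin 4) : DAHA q :=
  RingQuot.mkAlgHom F (DAHARel q) (FreeAlgebra.ι F (.tinv i))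

/-- The image of a generator of `△_q`: `A ↦ t₁t₀ + (t₁t₀)⁻¹`, `B ↦ t₃t₀ + (t₃t₀)⁻¹`,
`C ↦ t₂t₀ + (t₂t₀)⁻¹`. -/
noncomputable def zetaGen : AWGen → DAHA q
  | .A => t q 1 * t q 0 + tinv q 0 * tinv q 1
  | .B => t q 3 * t q 0 + tinv q 0 * tinv q 3
  | .C => t q 2 * t q 0 + tinv q 0 * tinv q 2

theorem t_mul_tinv (i : Fin 4) : t q i * tinv q i = 1 := by
  simpa [t, tinv] using RingQuot.mkAlgHom_rel F (DAHARel.mul_inv (q := q) i)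

theorem tinv_mul_t (i : Fin 4) : tinv q i * t q i = 1 := by
  simpa [t, tinv] using RingQuot.mkAlgHom_rel F (DAHARel.inv_mul (q := q) i)

theorem t_add_tinv_comm (i : Fin 4) (x : DAHA q) :
    (t q i + tinv q i) * x = x * (t q i + tinv q i) := by
  obtain ⟨y, rfl⟩ := RingQuot.mkAlgHom_surjective F (DAHARel q) x
  simpa [t, tinv] using RingQuot.mkAlgHom_rel F (DAHARel.central (q := q) i y)

theorem t_prod : t q 0 * t q 1 * t q 2 * t q 3 = algebraMap F _ q⁻¹ := by
  simpa only [t, map_mul, AlgHom.commutes] using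
    RingQuot.mkAlgHom_rel F (DAHARel.prod (q := q))

end Algebras

/-! ### Facts needed for the homomorphism `△_q → ℌ_q` -/

section Zeta

variable {F R : Type*} [Field F] [Ring R] [Algebra F R]

theorem t0_commutes {t0 s0 t1 s1 : R} (h0 : t0 * s0 = 1) (h0' : s0 * t0 = 1)
    (z0 : ∀ x, (t0 + s0) * x = x * (t0 + s0)) (z1 : ∀ x, (t1 + s1) * x = x * (t1 + s1)) :
    t0 * (t1 * t0 + s0 * s1) = (t1 * t0 + s0 * s1) * t0 := by
  have e1 : t0 * (s0 * s1) = s1 := by rw [← mul_assoc, h0, one_mul]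
  have e2 := z1 t0
  have e3 := z0 t1
  have e4 := z0 (t1 * t0)
  have e5 : t1 * t0 * s0 = t1 := by rw [mul_assoc, h0, mul_one]
  have e6 : s0 * (t1 + s1) * t0 = t1 + s1 := by
    rw [mul_assoc, z1, ← mul_assoc, h0', one_mul]
  have e7 : t1 * t0 * (t0 + s0) = t1 * t0 * t0 + t1 := by rw [mul_add, e5]
  rw [e7] at e4
  simp only [mul_add, add_mul, ← mul_assoc] at *
  rw [e1]
  have e8 : s0 * s1 * t0 = t1 + s1 - s0 * t1 * t0 := by rw [← e6]; abel
  have e9 : t0 * t1 * t0 = t1 * t0 * t0 + t1 - s0 * t1 * t0 := by rw [← e4]; abel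
  rw [e8, e9]; abel

/-- The two descriptions `t₁t₀ + (t₁t₀)⁻¹ = t₀t₁ + (t₀t₁)⁻¹`. -/
theorem bracket_symm {t0 s0 t1 s1 : R} (h0 : t0 * s0 = 1) (h0' : s0 * t0 = 1)
    (z0 : ∀ x, (t0 + s0) * x = x * (t0 + s0)) (z1 : ∀ x, (t1 + s1) * x = x * (t1 + s1)) :
    t1 * t0 + s0 * s1 = t0 * t1 + s1 * s0 := by
  have e := t0_commutes h0 h0' z0 z1
  have e2 : t0 * (t1 * t0 + s0 * s1) * s0 = t1 * t0 + s0 * s1 := by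
    rw [e, mul_assoc, h0, mul_one]
  rw [← e2, mul_add, add_mul]
  congr 1
  · rw [mul_assoc, mul_assoc, h0, mul_one]
  · rw [← mul_assoc t0, h0, one_mul]

theorem aw_identity {q : F} (hq : q ≠ 0) {t0 t1 t2 t3 s0 s1 s2 s3 : R}
    (h0 : t0 * s0 = 1) (h0' : s0 * t0 = 1) (h1 : t1 * s1 = 1) (h1' : s1 * t1 = 1)
    (h2 : t2 * s2 = 1) (h3 : t3 * s3 = 1)
    (z0 : ∀ x, (t0 + s0) * x = x * (t0 + s0)) (z1 : ∀ x, (t1 + s1) * x = x * (t1 + s1))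
    (z2 : ∀ x, (t2 + s2) * x = x * (t2 + s2)) (z3 : ∀ x, (t3 + s3) * x = x * (t3 + s3))
    (hp : t0 * t1 * t2 * t3 = algebraMap F R q⁻¹) :
    q • ((t1 * t0 + s0 * s1) * (t3 * t0 + s0 * s3)) -
        q⁻¹ • ((t3 * t0 + s0 * s3) * (t1 * t0 + s0 * s1)) +
        (q ^ 2 - q⁻¹ ^ 2) • (t2 * t0 + s0 * s2) =
      (q - q⁻¹) • ((t1 + s1) * (t3 + s3) + (t2 + s2) * (q • s0 + q⁻¹ • t0)) := by
  have hC := bracket_symm h0 h0' z0 z2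
  rw [bracket_symm h0 h0' z0 z1]
  -- three-letter words
  have hp' : t0 * t1 * t2 * t3 = q⁻¹ • (1 : R) := by rw [hp, Algebra.algebraMap_eq_smul_one]
  have w012 : t0 * t1 * t2 = q⁻¹ • s3 := by
    calc t0 * t1 * t2 = t0 * t1 * t2 * (t3 * s3) := by rw [h3, mul_one]
      _ = (t0 * t1 * t2 * t3) * s3 := by noncomm_ring
      _ = _ := by rw [hp', smul_mul_assoc, one_mul]
  have w30 : t3 * (t0 * t1 * t2) = q⁻¹ • (1 : R) := by rw [w012, mul_smul_comm, h3]
  have w301 : t3 * t0 * t1 = q⁻¹ • s2 := by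
    calc t3 * t0 * t1 = t3 * (t0 * t1 * t2) * s2 := by
          rw [show t3 * (t0 * t1 * t2) * s2 = t3 * t0 * t1 * (t2 * s2) by noncomm_ring,
            h2, mul_one]
      _ = _ := by rw [w30, smul_mul_assoc, one_mul]
  have w30b : t3 * t0 = q⁻¹ • (s2 * s1) := by
    calc t3 * t0 = t3 * t0 * t1 * s1 := by rw [mul_assoc _ t1, h1, mul_one]
      _ = _ := by rw [w301, smul_mul_assoc]
  have v12 : t1 * t2 = q⁻¹ • (s0 * s3) := by
    calc t1 * t2 = s0 * (t0 * t1 * t2) := by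
          rw [show s0 * (t0 * t1 * t2) = (s0 * t0) * (t1 * t2) by noncomm_ring, h0', one_mul]
      _ = _ := by rw [w012, mul_smul_comm]
  have v12' : s0 * s3 = q • (t1 * t2) := by rw [v12, smul_smul, mul_inv_cancel₀ hq, one_smul]
  have v103 : s1 * s0 * s3 = q • t2 := by
    rw [mul_assoc, v12', mul_smul_comm, ← mul_assoc, h1', one_mul]
  have v210 : t1 * s2 * s1 * s0 = q • (t1 * t3) := by
    have : s2 * s1 = q • (t3 * t0) := by rw [w30b, smul_smul, mul_inv_cancel₀ hq, one_smul]
    rw [mul_assoc t1, this, mul_smul_comm, smul_mul_assoc, mul_assoc t1, mul_assoc t3, h0, mul_one]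
  -- reduce the squares
  have sq0 : t0 * t0 = (t0 + s0) * t0 - 1 := by rw [add_mul, h0']; abel
  have sq0' : s0 * s0 = (t0 + s0) * s0 - 1 := by rw [add_mul, h0]; abel
  -- `AB`
  have a1 : t0 * t1 * (t3 * t0) = q⁻¹ • ((t2 + s2) * t0) - (q⁻¹ * q⁻¹) • (s3 * s1) := by
    rw [w30b, mul_smul_comm, show s2 = (t2 + s2) - t2 by abel, sub_mul, z2,
      show t0 * t1 * (s1 * (t2 + s2) - t2 * s1) =
        t0 * (t1 * s1) * (t2 + s2) - t0 * t1 * t2 * s1 by noncomm_ring, h1, mul_one, w012,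
      smul_mul_assoc, smul_sub, smul_smul, ← z2]
    congr 4; abel
  have a2 : t0 * t1 * (s0 * s3) = (t1 + s1) * s3 - q • (t0 * t2) := by
    rw [show t0 * t1 * (s0 * s3) = t0 * ((t1 + s1) * (s0 * s3)) - t0 * (s1 * s0 * s3) by
      noncomm_ring, v103, mul_smul_comm, ← mul_assoc t0, ← z1,
      show (t1 + s1) * t0 * (s0 * s3) = (t1 + s1) * (t0 * s0) * s3 by noncomm_ring, h0, mul_one]
  have a3 : s1 * s0 * (t3 * t0) = (t3 + s3) * s1 - q • (t2 * t0) := by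
    rw [show s1 * s0 * (t3 * t0) = s1 * s0 * (t3 + s3) * t0 - s1 * s0 * s3 * t0 by
      noncomm_ring, v103, smul_mul_assoc, ← z3,
      show (t3 + s3) * (s1 * s0) * t0 = (t3 + s3) * s1 * (s0 * t0) by noncomm_ring, h0', mul_one]
  have a4 : s1 * s0 * (s0 * s3) = q • ((t0 + s0) * t2) - s1 * s3 := by
    rw [show s1 * s0 * (s0 * s3) = s1 * (s0 * s0) * s3 by noncomm_ring, sq0',
      show s1 * ((t0 + s0) * s0 - 1) * s3 = s1 * (t0 + s0) * s0 * s3 - s1 * s3 by noncomm_ring,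
      ← z0, show (t0 + s0) * s1 * s0 * s3 = (t0 + s0) * (s1 * s0 * s3) by noncomm_ring, v103,
      mul_smul_comm]
  -- `BA`
  have b1 : t3 * t0 * (t0 * t1) = q⁻¹ • ((t0 + s0) * s2) - t3 * t1 := by
    rw [show t3 * t0 * (t0 * t1) = t3 * (t0 * t0) * t1 by noncomm_ring, sq0,
      show t3 * ((t0 + s0) * t0 - 1) * t1 = t3 * (t0 + s0) * t0 * t1 - t3 * t1 by noncomm_ring,
      ← z0, show (t0 + s0) * t3 * t0 * t1 = (t0 + s0) * (t3 * t0 * t1) by noncomm_ring, w301,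
      mul_smul_comm]
  have b2 : t3 * t0 * (s1 * s0) = (t1 + s1) * t3 - q⁻¹ • (s2 * s0) := by
    rw [show t3 * t0 * (s1 * s0) = t3 * t0 * (t1 + s1) * s0 - t3 * t0 * t1 * s0 by
      noncomm_ring, w301, smul_mul_assoc, ← z1,
      show (t1 + s1) * (t3 * t0) * s0 = (t1 + s1) * t3 * (t0 * s0) by noncomm_ring, h0, mul_one]
  have b3 : s0 * s3 * (t0 * t1) = (t3 + s3) * t1 - q⁻¹ • (s0 * s2) := by
    rw [show s0 * s3 * (t0 * t1) = s0 * (t3 + s3) * t0 * t1 - s0 * (t3 * t0 * t1) by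
      noncomm_ring, w301, mul_smul_comm, ← z3,
      show (t3 + s3) * s0 * t0 * t1 = (t3 + s3) * (s0 * t0) * t1 by noncomm_ring, h0', mul_one]
  have b4 : s0 * s3 * (s1 * s0) = q • ((t2 + s2) * s0) - (q * q) • (t1 * t3) := by
    rw [v12', smul_mul_assoc,
      show t1 * t2 * (s1 * s0) = t1 * (t2 + s2) * (s1 * s0) - t1 * s2 * s1 * s0 by noncomm_ring,
      v210, ← z2,
      show (t2 + s2) * t1 * (s1 * s0) = (t2 + s2) * (t1 * s1) * s0 by noncomm_ring, h1, mul_one,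
      smul_sub, smul_smul]
  have f4 := z2 t0
  have f5 := z2 s0
  have f7 := z1 s3
  have f9 := z3 s1
  have hq2 : (q ^ 2 - q⁻¹ ^ 2) • (t2 * t0 + s0 * s2) =
      q ^ 2 • (t2 * t0 + s0 * s2) - q⁻¹ ^ 2 • (t0 * t2 + s2 * s0) := by
    rw [sub_smul, hC]
  rw [show (t0 * t1 + s1 * s0) * (t3 * t0 + s0 * s3) = t0 * t1 * (t3 * t0) +
      t0 * t1 * (s0 * s3) + s1 * s0 * (t3 * t0) + s1 * s0 * (s0 * s3) by noncomm_ring,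
    show (t3 * t0 + s0 * s3) * (t0 * t1 + s1 * s0) = t3 * t0 * (t0 * t1) +
      t3 * t0 * (s1 * s0) + s0 * s3 * (t0 * t1) + s0 * s3 * (s1 * s0) by noncomm_ring,
    a1, a2, a3, a4, b1, b2, b3, b4, hq2]
  simp only [add_mul, mul_add, mul_smul_comm] at f4 f5 f7 f9 ⊢
  linear_combination (norm := skip) (-(q ^ 2)) • f5 + (q⁻¹ ^ 2) • f4 + q⁻¹ • f7 + q • f9
  match_scalars <;> field_simp <;> ring

/-- The third distinguished element commutes with everything that commutes with `t₀`. -/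
theorem awElt_comm {q : F} (hq : q ≠ 0) (hq4 : q ^ 2 - q⁻¹ ^ 2 ≠ 0)
    {t0 t1 t2 t3 s0 s1 s2 s3 : R}
    (h0 : t0 * s0 = 1) (h0' : s0 * t0 = 1) (h1 : t1 * s1 = 1) (h1' : s1 * t1 = 1)
    (h2 : t2 * s2 = 1) (h3 : t3 * s3 = 1)
    (z0 : ∀ x, (t0 + s0) * x = x * (t0 + s0)) (z1 : ∀ x, (t1 + s1) * x = x * (t1 + s1))
    (z2 : ∀ x, (t2 + s2) * x = x * (t2 + s2)) (z3 : ∀ x, (t3 + s3) * x = x * (t3 + s3))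
    (hp : t0 * t1 * t2 * t3 = algebraMap F R q⁻¹) (x : R) (hx : t0 * x = x * t0) :
    awElt q (t2 * t0 + s0 * s2) (t1 * t0 + s0 * s1) (t3 * t0 + s0 * s3) * x =
      x * awElt q (t2 * t0 + s0 * s2) (t1 * t0 + s0 * s1) (t3 * t0 + s0 * s3) := by
  have key := aw_identity hq h0 h0' h1 h1' h2 h3 z0 z1 z2 z3 hp
  have e : awElt q (t2 * t0 + s0 * s2) (t1 * t0 + s0 * s1) (t3 * t0 + s0 * s3) =
      (q ^ 2 - q⁻¹ ^ 2)⁻¹ •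
        ((q - q⁻¹) • ((t1 + s1) * (t3 + s3) + (t2 + s2) * (q • s0 + q⁻¹ • t0))) := by
    rw [← key, smul_add, smul_smul, inv_mul_cancel₀ hq4, one_smul, awElt, add_comm]
  have hs : s0 * x = x * s0 := by
    calc s0 * x = s0 * x * (t0 * s0) := by rw [h0, mul_one]
      _ = s0 * (x * t0) * s0 := by noncomm_ring
      _ = (s0 * t0) * x * s0 := by rw [← hx]; noncomm_ring
      _ = x * s0 := by rw [h0', one_mul]
  have C1 : Commute (t1 + s1) x := z1 x
  have C2 : Commute (t2 + s2) x := z2 x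
  have C3 : Commute (t3 + s3) x := z3 x
  have D0 : Commute t0 x := hx
  have D1 : Commute s0 x := hs
  rw [e]
  exact ((((C1.mul_left C3).add_left (C2.mul_left
    ((D1.smul_left q).add_left (D0.smul_left q⁻¹)))).smul_left _).smul_left _)

/-- `q` is nonzero and not a root of unity. -/
structure Generic (q : F) : Prop where
  ne_zero : q ≠ 0
  pow_ne_one : ∀ n : ℕ, 0 < n → q ^ n ≠ 1

theorem Generic.denom_ne_zero {q : F} (hq : Generic q) : q ^ 2 - q⁻¹ ^ 2 ≠ 0 := by
  intro h
  apply hq.pow_ne_one 4 (by norm_num)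
  have h0 := hq.ne_zero
  field_simp at h
  linear_combination h

variable {q : F}

theorem t0_comm_zetaGen (g : AWGen) : t q 0 * zetaGen q g = zetaGen q g * t q 0 := by
  cases g <;> exact t0_commutes (t_mul_tinv q 0) (tinv_mul_t q 0) (t_add_tinv_comm q 0)
    (t_add_tinv_comm q _)

theorem zetaGen_rel (hq : Generic q) ⦃x y : FreeAlgebra F AWGen⦄ (h : AWRel q x y) :
    FreeAlgebra.lift F (zetaGen q) x = FreeAlgebra.lift F (zetaGen q) y := by
  have e (i : Fin 4) := t_mul_tinv q i
  have e' (i : Fin 4) := tinv_mul_t q i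
  have z (i : Fin 4) := t_add_tinv_comm q i
  have P : (t q 0 * t q 1 * t q 2 * t q 3) = q⁻¹ • (1 : DAHA q) := by
    rw [t_prod, Algebra.algebraMap_eq_smul_one]
  -- conjugation by `t₀`
  have cz (i : Fin 4) :
      t q 0 * t q i * tinv q 0 + t q 0 * tinv q i * tinv q 0 = t q i + tinv q i := by
    rw [← add_mul, ← mul_add, ← z, mul_assoc, e, mul_one]
  have cz' (i : Fin 4) :
      tinv q 0 * t q i * t q 0 + tinv q 0 * tinv q i * t q 0 = t q i + tinv q i := by
    rw [← add_mul, ← mul_add, ← z, mul_assoc, e', mul_one]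
  cases h with
  | commA g =>
    simp only [map_mul, FreeAlgebra.lift_ι_apply, awElt, map_add, map_sub, map_smul]
    have hB : tinv q 0 * t q 3 * t q 0 * t q 0 + tinv q 0 * (tinv q 0 * tinv q 3 * t q 0) =
        zetaGen q .B := by
      have := t0_comm_zetaGen (q := q) .B
      calc _ = tinv q 0 * (zetaGen q .B * t q 0) := by rw [zetaGen]; noncomm_ring
        _ = _ := by rw [← this, ← mul_assoc, e', one_mul]
    rw [← hB]
    refine awElt_comm hq.ne_zero hq.denom_ne_zero (e 0) (e' 0) ?_ ?_ (e 1) (e 2)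
      (z 0) (fun x => by rw [cz', z]) (z 1) (z 2) ?_ _ (t0_comm_zetaGen g)
    · calc _ = tinv q 0 * t q 3 * (t q 0 * tinv q 0) * tinv q 3 * t q 0 := by noncomm_ring
        _ = tinv q 0 * (t q 3 * tinv q 3) * t q 0 := by rw [e, mul_one]; noncomm_ring
        _ = 1 := by rw [e, mul_one, e']
    · calc _ = tinv q 0 * tinv q 3 * (t q 0 * tinv q 0) * t q 3 * t q 0 := by noncomm_ring
        _ = tinv q 0 * (tinv q 3 * t q 3) * t q 0 := by rw [e, mul_one]; noncomm_ring
        _ = 1 := by rw [e', mul_one, e']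
    · calc _ = (t q 0 * tinv q 0) * t q 3 * t q 0 * t q 1 * t q 2 * (t q 3 * tinv q 3) := by
            rw [e 3]; noncomm_ring
        _ = t q 3 * (t q 0 * t q 1 * t q 2 * t q 3) * tinv q 3 := by
            rw [e 0]; noncomm_ring
        _ = _ := by
            rw [P, mul_smul_comm, smul_mul_assoc, mul_one, e, Algebra.algebraMap_eq_smul_one]
  | commB g =>
    simp only [map_mul, FreeAlgebra.lift_ι_apply, awElt, map_add, map_sub, map_smul]
    have hA : t q 0 * t q 1 * tinv q 0 * t q 0 + tinv q 0 * (t q 0 * tinv q 1 * tinv q 0) =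
        zetaGen q .A := by
      rw [zetaGen, bracket_symm (e 0) (e' 0) (z 0) (z 1), mul_assoc _ (tinv q 0), e', mul_one,
        mul_assoc (t q 0), ← mul_assoc (tinv q 0), e', one_mul]
    rw [← hA]
    refine awElt_comm hq.ne_zero hq.denom_ne_zero (e 0) (e' 0) (e 2) (e' 2) (e 3) ?_
      (z 0) (z 2) (z 3) (fun x => by rw [cz, z]) ?_ _ (t0_comm_zetaGen g)
    · calc _ = t q 0 * t q 1 * (tinv q 0 * t q 0) * tinv q 1 * tinv q 0 := by noncomm_ring
        _ = t q 0 * (t q 1 * tinv q 1) * tinv q 0 := by rw [e', mul_one]; noncomm_ring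
        _ = 1 := by rw [e, mul_one, e]
    · calc _ = t q 0 * (tinv q 1 * (tinv q 0 * t q 0) * t q 1) * t q 2 * t q 3 * t q 0 *
              t q 1 * tinv q 0 := by rw [e', mul_one, e']; noncomm_ring
        _ = t q 0 * tinv q 1 * tinv q 0 * (t q 0 * t q 1 * t q 2 * t q 3) * t q 0 *
              t q 1 * tinv q 0 := by noncomm_ring
        _ = q⁻¹ • (t q 0 * (tinv q 1 * (tinv q 0 * t q 0) * t q 1) * tinv q 0) := by
            rw [P, mul_smul_comm, smul_mul_assoc, smul_mul_assoc, smul_mul_assoc]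
            congr 1; noncomm_ring
        _ = _ := by rw [e', mul_one, e', mul_one, e, Algebra.algebraMap_eq_smul_one]
  | commC g =>
    simp only [map_mul, FreeAlgebra.lift_ι_apply, awElt, map_add, map_sub, map_smul]
    exact awElt_comm hq.ne_zero hq.denom_ne_zero (e 0) (e' 0) (e 1) (e' 1) (e 2) (e 3)
      (z 0) (z 1) (z 2) (z 3) (t_prod q) _ (t0_comm_zetaGen g)

/-- The homomorphism `ζ : △_q → ℌ_q`. -/
noncomputable def zeta (hq : Generic q) : AW q →ₐ[F] DAHA q :=
  RingQuot.liftAlgHom F ⟨FreeAlgebra.lift F (zetaGen q), zetaGen_rel hq⟩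

theorem zeta_comm_t0 (hq : Generic q) (a : AW q) : t q 0 * zeta hq a = zeta hq a * t q 0 := by
  obtain ⟨x, rfl⟩ := RingQuot.mkAlgHom_surjective F (AWRel q) a
  rw [zeta, RingQuot.liftAlgHom_mkAlgHom_apply]
  induction x using FreeAlgebra.induction with
  | grade0 r => simpa using (Algebra.commutes r (t q 0)).symm
  | grade1 g => simpa using t0_comm_zetaGen g
  | mul a b ha hb => rw [map_mul, ← mul_assoc, ha, mul_assoc, hb, mul_assoc]
  | add a b ha hb => rw [map_add, mul_add, add_mul, ha, hb]

end Zeta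

/-! ### The module `E(k₀,k₁,k₂,k₃)` -/

section Even

variable {F : Type*} [Field F]

/-- Admissible parameters: `q ≠ 0` is not a root of unity, `d` is odd, the `kᵢ` are nonzero and
`k₀² = q^{-d-1}`. -/
structure EParam (q : F) (d : ℕ) (k₀ k₁ k₂ k₃ : F) : Prop where
  generic : Generic q
  odd : Odd d
  k₀_ne : k₀ ≠ 0
  k₁_ne : k₁ ≠ 0
  k₂_ne : k₂ ≠ 0
  k₃_ne : k₃ ≠ 0
  k₀_sq : k₀ ^ 2 = q ^ (-(d : ℤ) - 1)

/-- The standard basis vector `vᵢ` of `F^{d+1}` for `0 ≤ i ≤ d` (and `0` for `i > d`, a value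
which is not used in the formulas below). -/
def v (F : Type*) [Field F] (d i : ℕ) : Fin (d + 1) → F :=
  fun j => if (j : ℕ) = i then 1 else 0

/-- The vector `t₀ vᵢ`. -/
def t₀v (q : F) (d : ℕ) (k₀ : F) (i : ℕ) : Fin (d + 1) → F :=
  if i = 0 then k₀ • v F d 0
  else if i = d then k₀ • v F d d
  else if Even i then
    (k₀⁻¹ * (q ^ i)⁻¹ * (1 - q ^ i) * (1 - k₀ ^ 2 * q ^ i)) • v F d (i - 1) +
      (k₀ + k₀⁻¹ - k₀⁻¹ * (q ^ i)⁻¹) • v F d i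
  else (k₀⁻¹ * (q ^ (i + 1))⁻¹) • (v F d i - v F d (i + 1))

/-- The vector `t₁ vᵢ`. -/
def t₁v (q : F) (d : ℕ) (k₀ k₁ : F) (i : ℕ) : Fin (d + 1) → F :=
  if i = 0 then k₁ • v F d 0 + k₁⁻¹ • v F d 1
  else if Even i then
    (-k₁ * (1 - q ^ i) * (1 - k₀ ^ 2 * q ^ i)) • v F d (i - 1) + k₁ • v F d i +
      k₁⁻¹ • v F d (i + 1)
  else k₁⁻¹ • v F d i

/-- The vector `t₂ vᵢ`. -/
def t₂v (q : F) (d : ℕ) (k₀ k₁ k₂ k₃ : F) (i : ℕ) : Fin (d + 1) → F :=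
  if Even i then
    (k₀⁻¹ * k₁⁻¹ * k₃⁻¹ * (q ^ (i + 1))⁻¹) • (v F d i - v F d (i + 1))
  else
    ((k₀ * k₁ * k₃ * q ^ i - k₂) * (k₀ * k₁ * k₃ * q ^ i - k₂⁻¹) / (k₀ * k₁ * k₃ * q ^ i)) •
        v F d (i - 1) +
      (k₂ + k₂⁻¹ - k₀⁻¹ * k₁⁻¹ * k₃⁻¹ * (q ^ i)⁻¹) • v F d i

/-- The vector `t₃ vᵢ`. -/
def t₃v (q : F) (d : ℕ) (k₀ k₁ k₂ k₃ : F) (i : ℕ) : Fin (d + 1) → F :=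
  if Even i then k₃ • v F d i
  else if i = d then
    (-k₃⁻¹ * (k₀ * k₁ * k₃ * q ^ d - k₂) * (k₀ * k₁ * k₃ * q ^ d - k₂⁻¹)) • v F d (d - 1) +
      k₃⁻¹ • v F d d
  else
    (-k₃⁻¹ * (k₀ * k₁ * k₃ * q ^ i - k₂) * (k₀ * k₁ * k₃ * q ^ i - k₂⁻¹)) • v F d (i - 1) +
      k₃⁻¹ • v F d i + k₃ • v F d (i + 1)

/-- The endomorphism of `F^{d+1}` that sends `vᵢ` to `f i` for `i = 0,…,d`. -/
noncomputable def endo (d : ℕ) (f : ℕ → Fin (d + 1) → F) : Module.End F (Fin (d + 1) → F) :=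
  (Pi.basisFun F (Fin (d + 1))).constr F (fun i => f i)

/-- The endomorphisms by which `t₀, t₁, t₂, t₃` act on `E(k₀,k₁,k₂,k₃)`. -/
noncomputable def tE (q : F) (d : ℕ) (k₀ k₁ k₂ k₃ : F) :
    Fin 4 → Module.End F (Fin (d + 1) → F) :=
  ![endo d (t₀v q d k₀), endo d (t₁v q d k₀ k₁), endo d (t₂v q d k₀ k₁ k₂ k₃),
    endo d (t₃v q d k₀ k₁ k₂ k₃)]

/-- The endomorphisms by which the generators act: `tᵢ⁻¹ = (kᵢ + kᵢ⁻¹) - tᵢ`, that is,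
`cᵢ = tᵢ + tᵢ⁻¹` acts as multiplication by `kᵢ + kᵢ⁻¹`. -/
noncomputable def genE (q : F) (d : ℕ) (k₀ k₁ k₂ k₃ : F) :
    DAHAGen → Module.End F (Fin (d + 1) → F)
  | .t i => tE q d k₀ k₁ k₂ k₃ i
  | .tinv i => algebraMap F _ ((![k₀, k₁, k₂, k₃] i) + (![k₀, k₁, k₂, k₃] i)⁻¹) -
      tE q d k₀ k₁ k₂ k₃ i

theorem endo_v {d : ℕ} (f : ℕ → Fin (d + 1) → F) {i : ℕ} (hi : i ≤ d) :
    endo d f (v F d i) = f i := by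
  have : v F d i = Pi.basisFun F (Fin (d + 1)) ⟨i, by omega⟩ := by
    ext j; simp [v, Pi.single_apply, Fin.ext_iff]
  rw [this, endo, Module.Basis.constr_basis]

theorem v_zero {d i : ℕ} (hi : d < i) : v F d i = 0 := by
  ext j; have := j.2; simp [v]; omega

theorem end_ext {d : ℕ} {f g : Module.End F (Fin (d + 1) → F)}
    (h : ∀ i ≤ d, f (v F d i) = g (v F d i)) : f = g := by
  refine (Pi.basisFun F (Fin (d + 1))).ext fun i => ?_
  have : v F d i = Pi.basisFun F (Fin (d + 1)) i := by
    ext j; simp [v, Pi.single_apply, Fin.ext_iff]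
  rw [← this]; exact h i (by omega)

section Formulas

set_option linter.unnecessarySeqFocus false

variable {q : F} {d : ℕ} {k₀ k₁ k₂ k₃ : F}

theorem EParam.k₀_sq' (h : EParam q d k₀ k₁ k₂ k₃) : k₀ ^ 2 * q ^ (d + 1) = 1 := by
  have h0 := h.generic.ne_zero
  rw [h.k₀_sq, ← zpow_natCast, ← zpow_add₀ h0]
  simp

/-- Uniform form of the action of `t₀` on odd basis vectors. -/
theorem t₀_odd (h : EParam q d k₀ k₁ k₂ k₃) {m : ℕ} (hm : 2 * m + 1 ≤ d) :
    endo d (t₀v q d k₀) (v F d (2 * m + 1)) =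
      (k₀⁻¹ * (q ^ (2 * m + 2))⁻¹) • (v F d (2 * m + 1) - v F d (2 * m + 2)) := by
  have h0 := h.generic.ne_zero
  have hk := h.k₀_ne
  rw [endo_v _ hm, t₀v, if_neg (by omega)]
  split_ifs with h1 h2
  · rw [v_zero (i := 2 * m + 2) (by omega), sub_zero, h1]
    congr 1
    have := h.k₀_sq'
    rw [← h1] at this
    field_simp
    linear_combination this
  · exact absurd h2 (by simp [parity_simps])
  · rfl

theorem t₀_zero : endo d (t₀v q d k₀) (v F d 0) = k₀ • v F d 0 := by
  rw [endo_v _ (by omega), t₀v, if_pos rfl]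

theorem t₀_even (h : EParam q d k₀ k₁ k₂ k₃) {m : ℕ} (hm : 2 * m + 2 ≤ d) :
    endo d (t₀v q d k₀) (v F d (2 * m + 2)) =
      (k₀⁻¹ * (q ^ (2 * m + 2))⁻¹ * (1 - q ^ (2 * m + 2)) * (1 - k₀ ^ 2 * q ^ (2 * m + 2))) •
        v F d (2 * m + 1) + (k₀ + k₀⁻¹ - k₀⁻¹ * (q ^ (2 * m + 2))⁻¹) • v F d (2 * m + 2) := by
  have ho := h.odd
  rw [endo_v _ hm, t₀v, if_neg (by omega), if_neg (by grind), if_pos (by simp [parity_simps])]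
  rfl

theorem t₁_zero : endo d (t₁v q d k₀ k₁) (v F d 0) = k₁ • v F d 0 + k₁⁻¹ • v F d 1 := by
  rw [endo_v _ (by omega), t₁v, if_pos rfl]

theorem t₁_even {m : ℕ} (hm : 2 * m + 2 ≤ d) :
    endo d (t₁v q d k₀ k₁) (v F d (2 * m + 2)) =
      (-k₁ * (1 - q ^ (2 * m + 2)) * (1 - k₀ ^ 2 * q ^ (2 * m + 2))) • v F d (2 * m + 1) +
        k₁ • v F d (2 * m + 2) + k₁⁻¹ • v F d (2 * m + 3) := by
  rw [endo_v _ hm, t₁v, if_neg (by omega), if_pos (by simp [parity_simps])]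
  rfl

theorem t₁_odd {m : ℕ} (hm : 2 * m + 1 ≤ d) :
    endo d (t₁v q d k₀ k₁) (v F d (2 * m + 1)) = k₁⁻¹ • v F d (2 * m + 1) := by
  rw [endo_v _ hm, t₁v, if_neg (by omega), if_neg (by simp [parity_simps])]

theorem t₁_one (hd : 1 ≤ d) : endo d (t₁v q d k₀ k₁) (v F d 1) = k₁⁻¹ • v F d 1 :=
  t₁_odd (m := 0) hd

theorem t₁_odd' {m : ℕ} (hm : 2 * m + 3 ≤ d) :
    endo d (t₁v q d k₀ k₁) (v F d (2 * m + 3)) = k₁⁻¹ • v F d (2 * m + 3) :=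
  t₁_odd (m := m + 1) hm

theorem t₂_even {m : ℕ} (hm : 2 * m ≤ d) :
    endo d (t₂v q d k₀ k₁ k₂ k₃) (v F d (2 * m)) =
      (k₀⁻¹ * k₁⁻¹ * k₃⁻¹ * (q ^ (2 * m + 1))⁻¹) • (v F d (2 * m) - v F d (2 * m + 1)) := by
  rw [endo_v _ hm, t₂v, if_pos (by simp)]

theorem t₂_odd {m : ℕ} (hm : 2 * m + 1 ≤ d) :
    endo d (t₂v q d k₀ k₁ k₂ k₃) (v F d (2 * m + 1)) =
      ((k₀ * k₁ * k₃ * q ^ (2 * m + 1) - k₂) * (k₀ * k₁ * k₃ * q ^ (2 * m + 1) - k₂⁻¹) /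
        (k₀ * k₁ * k₃ * q ^ (2 * m + 1))) • v F d (2 * m) +
      (k₂ + k₂⁻¹ - k₀⁻¹ * k₁⁻¹ * k₃⁻¹ * (q ^ (2 * m + 1))⁻¹) • v F d (2 * m + 1) := by
  rw [endo_v _ hm, t₂v, if_neg (by simp [parity_simps])]
  rfl

theorem t₃_even {m : ℕ} (hm : 2 * m ≤ d) :
    endo d (t₃v q d k₀ k₁ k₂ k₃) (v F d (2 * m)) = k₃ • v F d (2 * m) := by
  rw [endo_v _ hm, t₃v, if_pos (by simp)]

theorem t₃_odd {m : ℕ} (hm : 2 * m + 1 ≤ d) :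
    endo d (t₃v q d k₀ k₁ k₂ k₃) (v F d (2 * m + 1)) =
      (-k₃⁻¹ * (k₀ * k₁ * k₃ * q ^ (2 * m + 1) - k₂) *
        (k₀ * k₁ * k₃ * q ^ (2 * m + 1) - k₂⁻¹)) • v F d (2 * m) +
      k₃⁻¹ • v F d (2 * m + 1) + k₃ • v F d (2 * m + 2) := by
  rw [endo_v _ hm, t₃v, if_neg (by simp [parity_simps])]
  split_ifs with h1
  · rw [v_zero (i := 2 * m + 2) (by omega), smul_zero, add_zero, ← h1]
    rfl
  · rfl

/-- The quadratic relation of `tᵢ` on `E(k₀,k₁,k₂,k₃)`. -/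
theorem tE_quad (h : EParam q d k₀ k₁ k₂ k₃) (i : Fin 4) :
    tE q d k₀ k₁ k₂ k₃ i * tE q d k₀ k₁ k₂ k₃ i =
      ((![k₀, k₁, k₂, k₃] i) + (![k₀, k₁, k₂, k₃] i)⁻¹) • tE q d k₀ k₁ k₂ k₃ i - 1 := by
  have hq := h.generic.ne_zero
  have h0 := h.k₀_ne
  have h1 := h.k₁_ne
  have h2 := h.k₂_ne
  have h3 := h.k₃_ne
  have ho := h.odd
  refine end_ext fun j hj => ?_
  obtain ⟨m, rfl | rfl⟩ := Nat.even_or_odd' j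
  · have hj' : 2 * m + 1 ≤ d := by grind
    fin_cases i <;>
      simp only [tE, Module.End.mul_apply, LinearMap.sub_apply, LinearMap.smul_apply,
        Module.End.one_apply, Fin.zero_eta, Fin.mk_one, Fin.reduceFinMk, Matrix.cons_val]
    · rcases m with _ | m
      · simp only [mul_zero, t₀_zero, map_smul]
        match_scalars
        field_simp; ring
      · simp only [Nat.mul_succ, t₀_even h hj, t₀_odd h (m := m) (by omega), map_smul, map_add]
        match_scalars <;> field_simp <;> ring
    · rcases m with _ | m
      · simp only [mul_zero, t₁_zero, map_smul, map_add]
        rw [t₁_one hj']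
        match_scalars <;> field_simp <;> ring
      · have ho' : 2 * m + 1 ≤ d := by omega
        simp only [Nat.mul_succ, t₁_even hj, t₁_odd ho', t₁_odd' hj', map_smul, map_add]
        match_scalars <;> field_simp <;> ring
    · simp only [t₂_even hj, t₂_odd hj', map_smul, map_sub]
      match_scalars <;> field_simp <;> ring
    · simp only [t₃_even hj, map_smul]
      match_scalars <;> field_simp <;> ring
  · have hj' : 2 * m ≤ d := by omega
    fin_cases i <;>
      simp only [tE, Module.End.mul_apply, LinearMap.sub_apply, LinearMap.smul_apply,
        Module.End.one_apply, Fin.zero_eta, Fin.mk_one, Fin.reduceFinMk, Matrix.cons_val]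
    · rcases Nat.lt_or_ge d (2 * m + 2) with hd | hd
      · have hm : d = 2 * m + 1 := by omega
        have hs := h.k₀_sq'
        simp only [t₀_odd h hj, v_zero hd, sub_zero, map_smul]
        rw [hm] at hs
        match_scalars
        field_simp
        grind
      · simp only [t₀_odd h hj, t₀_even h hd, map_smul, map_sub]
        match_scalars <;> field_simp <;> ring
    · simp only [t₁_odd hj, map_smul]
      match_scalars <;> field_simp <;> ring
    · simp only [t₂_even hj', t₂_odd hj, map_smul, map_add]
      match_scalars <;> field_simp <;> ring
    · rcases Nat.lt_or_ge d (2 * m + 2) with hd | hd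
      · simp only [t₃_odd hj, t₃_even hj', v_zero hd, smul_zero, add_zero, map_smul, map_add]
        match_scalars <;> field_simp <;> ring
      · simp only [t₃_odd hj, t₃_even hj', map_smul, map_add]
        rw [show 2 * m + 2 = 2 * (m + 1) by ring, t₃_even (by omega)]
        match_scalars <;> field_simp <;> ring

/-- The relation `t₀t₁t₂t₃ = q⁻¹` on `E(k₀,k₁,k₂,k₃)`. -/
theorem tE_prod (h : EParam q d k₀ k₁ k₂ k₃) :
    tE q d k₀ k₁ k₂ k₃ 0 * tE q d k₀ k₁ k₂ k₃ 1 * tE q d k₀ k₁ k₂ k₃ 2 *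
      tE q d k₀ k₁ k₂ k₃ 3 = q⁻¹ • 1 := by
  have hq := h.generic.ne_zero
  have h0 := h.k₀_ne
  have h1 := h.k₁_ne
  have h2 := h.k₂_ne
  have h3 := h.k₃_ne
  have ho := h.odd
  have E (m : ℕ) (hj : 2 * m ≤ d) :
      endo d (t₀v q d k₀) (endo d (t₁v q d k₀ k₁)
        (endo d (t₂v q d k₀ k₁ k₂ k₃) (v F d (2 * m)))) = (q⁻¹ * k₃⁻¹) • v F d (2 * m) := by
    have hj' : 2 * m + 1 ≤ d := by grind
    rcases m with _ | m
    · rw [t₂_even hj]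
      simp only [mul_zero, map_smul, map_sub, t₁_zero, map_add]
      rw [zero_add, t₁_one hj', map_smul, t₀_zero]
      match_scalars <;> field_simp <;> ring
    · rw [t₂_even hj]
      simp only [Nat.mul_succ, map_smul, map_sub, t₁_even hj, map_add]
      rw [t₁_odd' hj', map_smul, t₀_even h hj, t₀_odd h (m := m) (by omega)]
      match_scalars <;> field_simp <;> ring
  have G (m : ℕ) (hj : 2 * m + 1 ≤ d) :
      endo d (t₀v q d k₀) (endo d (t₁v q d k₀ k₁) (v F d (2 * m))) =
        (k₀ * k₁ * q ^ (2 * m)) • v F d (2 * m) +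
          k₁⁻¹ • endo d (t₀v q d k₀) (v F d (2 * m + 1)) := by
    have e := E m (by omega)
    rw [t₂_even (by omega)] at e
    simp only [map_smul, map_sub, t₁_odd hj] at e
    have e' := congrArg (fun x => (k₀ * k₁ * k₃ * q ^ (2 * m + 1)) • x) e
    simp only [smul_smul] at e'
    rw [show k₀ * k₁ * k₃ * q ^ (2 * m + 1) * (k₀⁻¹ * k₁⁻¹ * k₃⁻¹ * (q ^ (2 * m + 1))⁻¹) = 1 by
      field_simp, one_smul, sub_eq_iff_eq_add] at e'
    rw [e']
    congr 2
    field_simp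
    ring
  refine end_ext fun j hj => ?_
  simp only [tE, Module.End.mul_apply, LinearMap.smul_apply, Module.End.one_apply,
    Matrix.cons_val]
  obtain ⟨m, rfl | rfl⟩ := Nat.even_or_odd' j
  · rw [t₃_even hj]
    simp only [map_smul, E m hj]
    match_scalars
    field_simp
  · have hj' : 2 * m ≤ d := by omega
    rw [t₃_odd hj]
    simp only [map_smul, map_add, E m hj', t₂_odd hj]
    rw [G m hj, t₁_odd hj, map_smul, t₀_odd h hj]
    rcases Nat.lt_or_ge d (2 * m + 2) with hd | hd
    · simp only [v_zero hd, sub_zero, smul_zero, add_zero, map_zero]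
      match_scalars <;> field_simp <;> ring
    · rw [show 2 * m + 2 = 2 * (m + 1) by ring, E (m + 1) (by omega)]
      match_scalars <;> field_simp <;> ring

end Formulas

theorem genE_rel {q : F} {d : ℕ} {k₀ k₁ k₂ k₃ : F} (h : EParam q d k₀ k₁ k₂ k₃)
    ⦃x y : FreeAlgebra F DAHAGen⦄ (r : DAHARel q x y) :
    FreeAlgebra.lift F (genE q d k₀ k₁ k₂ k₃) x =
      FreeAlgebra.lift F (genE q d k₀ k₁ k₂ k₃) y := by
  cases r with
  | mul_inv i =>
    simp only [map_mul, map_one, FreeAlgebra.lift_ι_apply, genE, mul_sub, tE_quad h i]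
    rw [← Algebra.commutes, ← Algebra.smul_def, sub_sub_cancel]
  | inv_mul i =>
    simp only [map_mul, map_one, FreeAlgebra.lift_ι_apply, genE, sub_mul, tE_quad h i]
    rw [← Algebra.smul_def, sub_sub_cancel]
  | central i x =>
    simp only [map_mul, map_add, FreeAlgebra.lift_ι_apply, genE, add_sub_cancel]
    rw [← map_add]
    exact Algebra.commutes (R := F) (A := Module.End F (Fin (d + 1) → F)) _ _
  | prod =>
    simp only [map_mul, FreeAlgebra.lift_ι_apply, genE, AlgHom.commutes]
    rw [tE_prod h, Algebra.algebraMap_eq_smul_one]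

/-- The representation of `ℌ_q` on `E(k₀,k₁,k₂,k₃)`. -/
noncomputable def repE {q : F} {d : ℕ} {k₀ k₁ k₂ k₃ : F} (h : EParam q d k₀ k₁ k₂ k₃) :
    DAHA q →ₐ[F] Module.End F (Fin (d + 1) → F) :=
  RingQuot.liftAlgHom F ⟨FreeAlgebra.lift F (genE q d k₀ k₁ k₂ k₃), genE_rel h⟩

/-- The underlying space `F^{d+1}` of the `ℌ_q`-module `E(k₀,k₁,k₂,k₃)`. -/
def E {q : F} {d : ℕ} {k₀ k₁ k₂ k₃ : F} (_ : EParam q d k₀ k₁ k₂ k₃) : Type _ :=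
  Fin (d + 1) → F

variable {q : F} {d : ℕ} {k₀ k₁ k₂ k₃ : F} (h : EParam q d k₀ k₁ k₂ k₃)

instance : AddCommGroup (E h) := inferInstanceAs (AddCommGroup (Fin (d + 1) → F))

instance : Module F (E h) := inferInstanceAs (Module F (Fin (d + 1) → F))

/-- The action of `ℌ_q` on `E(k₀,k₁,k₂,k₃)`. -/
noncomputable instance : Module (DAHA q) (E h) :=
  Module.compHom (Fin (d + 1) → F) (repE h).toRingHom

theorem smul_def_E (x : DAHA q) (w : E h) : x • w = repE h x w := rfl

instance : IsScalarTower F (DAHA q) (E h) where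
  smul_assoc a x w := by rw [smul_def_E, smul_def_E, map_smul]; rfl

/-- The action of `△_q` on `E(k₀,k₁,k₂,k₃)`, pulled back along `ζ`. -/
noncomputable instance : Module (AW q) (E h) :=
  Module.compHom (E h) (zeta h.generic).toRingHom

theorem aw_smul_def (a : AW q) (w : E h) : a • w = zeta h.generic a • w := rfl

/-- The `t₀`-eigenspace `E(k₀,k₁,k₂,k₃)(θ) = {w | t₀ w = θ w}`, as a `△_q`-submodule. -/
noncomputable def eigen (θ : F) : Submodule (AW q) (E h) where
  carrier := {w | t q 0 • w = θ • w}
  add_mem' {a b} ha hb := by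
    simp only [Set.mem_ofPred_eq] at *
    rw [smul_add, ha, hb, smul_add]
  zero_mem' := by simp
  smul_mem' a w hw := by
    simp only [Set.mem_ofPred_eq] at *
    rw [aw_smul_def, smul_smul, zeta_comm_t0, mul_smul, hw, ← algebraMap_smul (DAHA q) θ w,
      smul_smul, ← Algebra.commutes, mul_smul, algebraMap_smul]

end Even

end DahaAW

open DahaAW

namespace DahaAW

/-! ### Words in the generators of `ℌ_q` -/

section Words

variable {F : Type*} [Field F] (q : F)

theorem t_mul_tinv_cancel (i : Fin 4) (x : DAHA q) : t q i * (tinv q i * x) = x := by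
  rw [← mul_assoc, t_mul_tinv, one_mul]

theorem tinv_mul_t_cancel (i : Fin 4) (x : DAHA q) : tinv q i * (t q i * x) = x := by
  rw [← mul_assoc, tinv_mul_t, one_mul]

theorem t_prod_smul : t q 0 * (t q 1 * (t q 2 * t q 3)) = q⁻¹ • (1 : DAHA q) := by
  rw [← Algebra.algebraMap_eq_smul_one, ← t_prod]
  simp only [mul_assoc]

theorem t2_mul_t3 : t q 2 * t q 3 = q⁻¹ • (tinv q 1 * tinv q 0) := by
  have e := congrArg (fun x => tinv q 1 * (tinv q 0 * x)) (t_prod_smul q)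
  simpa only [tinv_mul_t_cancel, mul_smul_comm, mul_one] using e

theorem t1_mul_t2 : t q 1 * t q 2 = q⁻¹ • (tinv q 0 * tinv q 3) := by
  have e := congrArg (fun x => tinv q 0 * x * tinv q 3) (t_prod_smul q)
  simpa only [tinv_mul_t_cancel, mul_smul_comm, smul_mul_assoc, mul_one, mul_assoc,
    t_mul_tinv] using e

theorem t3_mul_t0_mul_t1 : t q 3 * (t q 0 * t q 1) = q⁻¹ • tinv q 2 := by
  have e := congrArg (fun x => t q 3 * (x * (tinv q 3 * tinv q 2))) (t_prod_smul q)
  simpa only [t_mul_tinv_cancel, mul_smul_comm, smul_mul_assoc, mul_one, one_mul, mul_assoc,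
    t_mul_tinv] using e

variable {q}

theorem tinv2_mul_tinv1 (hq : q ≠ 0) : tinv q 2 * tinv q 1 = q • (t q 3 * t q 0) := by
  have e := congrArg (fun x => q • (x * tinv q 1)) (t3_mul_t0_mul_t1 q)
  simpa only [smul_mul_assoc, smul_smul, mul_inv_cancel₀ hq, one_smul, mul_assoc, t_mul_tinv,
    mul_one] using e.symm

theorem tinv3_mul_tinv2 (hq : q ≠ 0) : tinv q 3 * tinv q 2 = q • (t q 0 * t q 1) := by
  have e := congrArg (fun x => q • (tinv q 3 * x)) (t3_mul_t0_mul_t1 q)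
  simpa only [mul_smul_comm, smul_smul, mul_inv_cancel₀ hq, one_smul, tinv_mul_t_cancel]
    using e.symm

theorem tinv1_mul_tinv0_mul_tinv3 (hq : q ≠ 0) :
    tinv q 1 * (tinv q 0 * tinv q 3) = q • t q 2 := by
  have e := congrArg (fun x => q • (tinv q 1 * x)) (t1_mul_t2 q)
  simpa only [mul_smul_comm, smul_smul, mul_inv_cancel₀ hq, one_smul, tinv_mul_t_cancel]
    using e.symm

end Words

/-! ### Submodules of `E(k₀,k₁,k₂,k₃)` -/

section Action

variable {F : Type*} [Field F] {q : F} {d : ℕ} {k₀ k₁ k₂ k₃ : F}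
  (h : EParam q d k₀ k₁ k₂ k₃)

theorem t_smul (i : Fin 4) (w : E h) : t q i • w = tE q d k₀ k₁ k₂ k₃ i w := by
  rw [smul_def_E, repE, t, RingQuot.liftAlgHom_mkAlgHom_apply, FreeAlgebra.lift_ι_apply, genE]

theorem tinv_smul (i : Fin 4) (w : E h) :
    tinv q i • w = ((![k₀, k₁, k₂, k₃] i) + (![k₀, k₁, k₂, k₃] i)⁻¹) • w - t q i • w := by
  rw [t_smul, smul_def_E, repE, tinv, RingQuot.liftAlgHom_mkAlgHom_apply,
    FreeAlgebra.lift_ι_apply, genE]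
  rfl

instance : IsScalarTower F (AW q) (E h) where
  smul_assoc a x w := by rw [aw_smul_def, aw_smul_def, map_smul, smul_assoc]

/-- The `ℌ_q`-submodule on an `F`-subspace that is stable under `t₀, t₁, t₂, t₃`. -/
def dahaSubmodule (U : Submodule F (E h)) (hU : ∀ i, ∀ x ∈ U, t q i • x ∈ U) :
    Submodule (DAHA q) (E h) where
  toAddSubmonoid := U.toAddSubmonoid
  smul_mem' a x hx := by
    change a • x ∈ U
    replace hx : x ∈ U := hx
    obtain ⟨y, rfl⟩ := RingQuot.mkAlgHom_surjective F (DAHARel q) a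
    induction y using FreeAlgebra.induction generalizing x with
    | grade0 r =>
      rw [AlgHom.commutes, algebraMap_smul]
      exact U.smul_mem r hx
    | grade1 g =>
      cases g with
      | t i => exact hU i x hx
      | tinv i =>
        change tinv q i • x ∈ U
        rw [tinv_smul]
        exact U.sub_mem (U.smul_mem _ hx) (hU i x hx)
    | mul a b ha hb =>
      rw [map_mul, mul_smul]
      exact ha _ (hb _ hx)
    | add a b ha hb =>
      rw [map_add, add_smul]
      exact U.add_mem (ha _ hx) (hb _ hx)

/-- A subspace stable under `A, B, C` is stable under `t_i t_0 + (t_i t_0)⁻¹`. -/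
theorem bracket_smul_mem (W : Submodule (AW q) (E h)) {w : E h} (hw : w ∈ W) {i : Fin 4}
    (hi : i ≠ 0) : (t q i * t q 0 + tinv q 0 * tinv q i) • w ∈ W := by
  have key (g : AWGen) : zetaGen q g • w ∈ W := by
    have := W.smul_mem (RingQuot.mkAlgHom F (AWRel q) (FreeAlgebra.ι F g)) hw
    rwa [aw_smul_def, zeta, RingQuot.liftAlgHom_mkAlgHom_apply, FreeAlgebra.lift_ι_apply] at this
  fin_cases i
  · exact absurd rfl hi
  · exact key .A
  · exact key .C
  · exact key .B

theorem mem_eigen {θ : F} {w : E h} : w ∈ eigen h θ ↔ t q 0 • w = θ • w := Iff.rfl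

variable {h} {θ : F}

/-- For `w` in a `△_q`-submodule of the `θ`-eigenspace, `t₀ t_i w ≡ θ⁻¹ t_i w`. -/
theorem t0_smul_t_smul_sub_mem (hc : k₀ + k₀⁻¹ = θ + θ⁻¹)
    {W : Submodule (AW q) (E h)} (hW : W ≤ eigen h θ) {w : E h} (hw : w ∈ W) {i : Fin 4}
    (hi : i ≠ 0) : t q 0 • t q i • w - θ⁻¹ • t q i • w ∈ W := by
  have hb := bracket_smul_mem h W hw hi
  have h0 := (mem_eigen h).1 (hW hw)
  have e : t q 0 • t q i • w - θ⁻¹ • t q i • w =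
      (t q i * t q 0 + tinv q 0 * tinv q i) • w -
        ((![k₀, k₁, k₂, k₃] i + (![k₀, k₁, k₂, k₃] i)⁻¹) * θ⁻¹) • w := by
    generalize hci : ![k₀, k₁, k₂, k₃] i + (![k₀, k₁, k₂, k₃] i)⁻¹ = c
    rw [add_smul, mul_smul, mul_smul, tinv_smul h i, tinv_smul h 0, hci, Matrix.cons_val_zero,
      hc, smul_sub (t q 0), smul_comm (t q 0) c w, h0, smul_comm (t q i) θ w]
    generalize t q 0 • t q i • w = y
    generalize t q i • w = x
    module
  rw [e]
  exact W.sub_mem hb (W.smul_of_tower_mem _ hw)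

/-- The span of `t₀W, t₁W, t₂W, t₃W`. -/
def tSpan (W : Submodule (AW q) (E h)) : Submodule F (E h) :=
  Submodule.span F {x | ∃ i, ∃ w ∈ W, t q i • w = x}

theorem t_smul_mem_tSpan {W : Submodule (AW q) (E h)} {w : E h} (hw : w ∈ W) (i : Fin 4) :
    t q i • w ∈ tSpan W :=
  Submodule.subset_span ⟨i, w, hw, rfl⟩

theorem mem_tSpan (hθ : θ ≠ 0) {W : Submodule (AW q) (E h)} (hW : W ≤ eigen h θ) {w : E h}
    (hw : w ∈ W) : w ∈ tSpan W := by
  have := (tSpan W).smul_mem θ⁻¹ (t_smul_mem_tSpan hw 0)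
  rwa [(mem_eigen h).1 (hW hw), smul_smul, inv_mul_cancel₀ hθ, one_smul] at this

theorem tinv_smul_mem_iff {U : Submodule F (E h)} {x : E h} (hx : x ∈ U) (i : Fin 4) :
    tinv q i • x ∈ U ↔ t q i • x ∈ U := by
  rw [tinv_smul, U.sub_mem_iff_right (U.smul_mem _ hx)]

theorem t_smul_t_smul_mem_tSpan (hθ : θ ≠ 0) (hc : k₀ + k₀⁻¹ = θ + θ⁻¹)
    {W : Submodule (AW q) (E h)} (hW : W ≤ eigen h θ) {w : E h} (hw : w ∈ W) (i j : Fin 4) :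
    t q i • t q j • w ∈ tSpan W := by
  have hq := h.generic.ne_zero
  have m {x : E h} (hx : x ∈ W) : x ∈ tSpan W := mem_tSpan hθ hW hx
  have mt {x : E h} (hx : x ∈ W) (i : Fin 4) : t q i • x ∈ tSpan W := t_smul_mem_tSpan hx i
  have mi {x : E h} (hx : x ∈ W) (i : Fin 4) : tinv q i • x ∈ tSpan W :=
    (tinv_smul_mem_iff (m hx) i).2 (mt hx i)
  have h0 : t q 0 • w = θ • w := (mem_eigen h).1 (hW hw)
  have h0' : tinv q 0 • w = θ⁻¹ • w := by
    have := congrArg (fun x => θ⁻¹ • tinv q 0 • x) h0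
    simpa only [← mul_smul, tinv_mul_t, one_smul, smul_comm (tinv q 0) θ w, smul_smul,
      inv_mul_cancel₀ hθ] using this.symm
  -- left multiplication by `t₀`
  have left0 (j : Fin 4) : t q 0 • t q j • w ∈ tSpan W := by
    rcases eq_or_ne j 0 with rfl | hj
    · rw [h0, smul_comm]
      exact (tSpan W).smul_mem _ (mt hw 0)
    · have := m (t0_smul_t_smul_sub_mem hc hW hw hj)
      rwa [(tSpan W).sub_mem_iff_left ((tSpan W).smul_mem _ (mt hw j))] at this
  have right0 (i : Fin 4) : t q i • t q 0 • w ∈ tSpan W := by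
    rw [h0, smul_comm]
    exact (tSpan W).smul_mem _ (mt hw i)
  have left0i (j : Fin 4) : tinv q 0 • tinv q j • w ∈ tSpan W := by
    rw [tinv_smul_mem_iff (mi hw j), tinv_smul, smul_sub, smul_comm,
      (tSpan W).sub_mem_iff_right ((tSpan W).smul_mem _ (mt hw 0))]
    exact left0 j
  -- `t_i t_j w` and `t_i⁻¹ t_j⁻¹ w` lie in the span at the same time
  have inv_iff (i j : Fin 4) :
      tinv q i • tinv q j • w ∈ tSpan W ↔ t q i • t q j • w ∈ tSpan W := by
    rw [tinv_smul_mem_iff (mi hw j), tinv_smul h j, smul_sub, smul_comm,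
      (tSpan W).sub_mem_iff_right ((tSpan W).smul_mem _ (mt hw i))]
  have diag (i : Fin 4) : t q i • t q i • w ∈ tSpan W := by
    rw [← tinv_smul_mem_iff (mt hw i), ← mul_smul, tinv_mul_t, one_smul]
    exact m hw
  have h12 : t q 1 • t q 2 • w ∈ tSpan W := by
    rw [← mul_smul, t1_mul_t2, smul_assoc, mul_smul]
    exact (tSpan W).smul_mem _ (left0i 3)
  have h23 : t q 2 • t q 3 • w ∈ tSpan W := by
    rw [← mul_smul, t2_mul_t3, smul_assoc, mul_smul, h0', smul_comm (tinv q 1) θ⁻¹ w]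
    exact (tSpan W).smul_mem _ ((tSpan W).smul_mem _ (mi hw 1))
  have h21 : t q 2 • t q 1 • w ∈ tSpan W := by
    rw [← inv_iff, ← mul_smul, tinv2_mul_tinv1 hq, smul_assoc, mul_smul]
    exact (tSpan W).smul_mem _ (right0 3)
  have h32 : t q 3 • t q 2 • w ∈ tSpan W := by
    rw [← inv_iff, ← mul_smul, tinv3_mul_tinv2 hq, smul_assoc, mul_smul]
    exact (tSpan W).smul_mem _ (left0 1)
  have h31 : t q 3 • t q 1 • w ∈ tSpan W := by
    have e : t q 3 • t q 0 • t q 1 • w ∈ tSpan W := by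
      rw [← mul_smul (t q 0), ← mul_smul, t3_mul_t0_mul_t1, smul_assoc]
      exact (tSpan W).smul_mem _ (mi hw 2)
    have e' := mt (t0_smul_t_smul_sub_mem hc hW hw (i := 1) (by decide)) 3
    rw [smul_sub, (tSpan W).sub_mem_iff_right e, smul_comm,
      (tSpan W).smul_mem_iff (inv_ne_zero hθ)] at e'
    exact e'
  have h13 : t q 1 • t q 3 • w ∈ tSpan W := by
    have hb := bracket_smul_mem h W hw (i := 3) (by decide)
    have e : tinv q 1 • tinv q 0 • tinv q 3 • w ∈ tSpan W := by
      rw [← mul_smul (tinv q 0), ← mul_smul, tinv1_mul_tinv0_mul_tinv3 hq, smul_assoc]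
      exact (tSpan W).smul_mem _ (mt hw 2)
    have e' := mi hb 1
    rw [add_smul, mul_smul, mul_smul, smul_add, (tSpan W).add_mem_iff_left e, h0,
      smul_comm (t q 3) θ w, smul_comm (tinv q 1) θ, (tSpan W).smul_mem_iff hθ,
      tinv_smul_mem_iff (mt hw 3)] at e'
    exact e'
  fin_cases i <;> fin_cases j <;>
    first
    | exact left0 _ | exact right0 _ | exact diag _ | assumption

theorem tSpan_stable (hθ : θ ≠ 0) (hc : k₀ + k₀⁻¹ = θ + θ⁻¹)
    {W : Submodule (AW q) (E h)} (hW : W ≤ eigen h θ) (i : Fin 4) :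
    ∀ x ∈ tSpan W, t q i • x ∈ tSpan W := by
  intro x hx
  induction hx using Submodule.span_induction with
  | mem x hx =>
    obtain ⟨j, w, hw, rfl⟩ := hx
    exact t_smul_t_smul_mem_tSpan hθ hc hW hw i j
  | zero => rw [smul_zero]; exact zero_mem _
  | add x y _ _ hx hy => rw [smul_add]; exact add_mem hx hy
  | smul a x _ hx => rw [smul_comm]; exact (tSpan W).smul_mem a hx

theorem t0_smul_sub_mem (hc : k₀ + k₀⁻¹ = θ + θ⁻¹)
    {W : Submodule (AW q) (E h)} (hW : W ≤ eigen h θ) :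
    ∀ x ∈ tSpan W, t q 0 • x - θ⁻¹ • x ∈ W := by
  intro x hx
  induction hx using Submodule.span_induction with
  | mem x hx =>
    obtain ⟨j, w, hw, rfl⟩ := hx
    rcases eq_or_ne j 0 with rfl | hj
    · rw [(mem_eigen h).1 (hW hw), smul_comm, (mem_eigen h).1 (hW hw)]
      exact W.sub_mem (W.smul_of_tower_mem _ (W.smul_of_tower_mem _ hw))
        (W.smul_of_tower_mem _ (W.smul_of_tower_mem _ hw))
    · exact t0_smul_t_smul_sub_mem hc hW hw hj
  | zero => simp
  | add x y _ _ hx hy =>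
    rw [smul_add, smul_add, add_sub_add_comm]
    exact W.add_mem hx hy
  | smul a x _ hx =>
    rw [smul_comm (t q 0) a x, smul_comm θ⁻¹ a x, ← smul_sub]
    exact W.smul_of_tower_mem a hx

/-- If `E` is irreducible, every nonzero `△_q`-submodule of a `t₀`-eigenspace is the whole
eigenspace. -/
theorem eq_eigen_of_le (hirr : IsSimpleModule (DAHA q) (E h)) (hθ : θ ≠ 0)
    (hθ' : θ ≠ θ⁻¹) (hc : k₀ + k₀⁻¹ = θ + θ⁻¹) {W : Submodule (AW q) (E h)}
    (hW : W ≤ eigen h θ) (h0 : W ≠ ⊥) : W = eigen h θ := by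
  refine le_antisymm hW fun x hx => ?_
  have htop : dahaSubmodule h (tSpan W) (tSpan_stable hθ hc hW) = ⊤ := by
    refine (eq_bot_or_eq_top _).resolve_left fun hbot => h0 ?_
    rw [Submodule.eq_bot_iff]
    intro w hw
    have : w ∈ dahaSubmodule h (tSpan W) (tSpan_stable hθ hc hW) := mem_tSpan hθ hW hw
    rwa [hbot, Submodule.mem_bot] at this
  have hxU : x ∈ tSpan W := by
    have : x ∈ dahaSubmodule h (tSpan W) (tSpan_stable hθ hc hW) := htop ▸ Submodule.mem_top
    exact this
  have := W.smul_of_tower_mem (θ - θ⁻¹)⁻¹ (t0_smul_sub_mem hc hW x hxU)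
  rwa [(mem_eigen h).1 hx, ← sub_smul, smul_smul, inv_mul_cancel₀ (sub_ne_zero.2 hθ'),
    one_smul] at this

theorem isAtom_eigen (hirr : IsSimpleModule (DAHA q) (E h)) (hθ : θ ≠ 0)
    (hθ' : θ ≠ θ⁻¹) (hc : k₀ + k₀⁻¹ = θ + θ⁻¹) (h0 : eigen h θ ≠ ⊥) : IsAtom (eigen h θ) :=
  ⟨h0, fun _ hW => by_contra fun hne => hW.ne (eq_eigen_of_le hirr hθ hθ' hc hW.le hne)⟩

end Action

end DahaAW

/-- In a bounded modular lattice with complementary atoms `a`, `b` that have no common complement,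
the elements are `⊥, a, b, ⊤`. -/
theorem IsCompl.eq_of_isAtom_isAtom {L : Type*} [Lattice L] [BoundedOrder L] [IsModularLattice L]
    {a b : L} (hab : IsCompl a b) (ha : IsAtom a) (hb : IsAtom b)
    (hc : ∀ x, IsCompl x a → IsCompl x b → False) (x : L) :
    x = ⊥ ∨ x = a ∨ x = b ∨ x = ⊤ := by
  have above {a b : L} (hab : IsCompl a b) (hb : IsAtom b) {x : L} (hx : a ≤ x) :
      x = a ∨ x = ⊤ := by
    rcases hb.le_iff.1 (inf_le_left : b ⊓ x ≤ b) with e | e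
    · left
      calc x = (a ⊔ b) ⊓ x := by rw [hab.sup_eq_top, top_inf_eq]
        _ = a := by rw [sup_inf_assoc_of_le b hx, e, sup_bot_eq]
    · right
      exact top_le_iff.1 (hab.sup_eq_top ▸ sup_le hx (inf_eq_left.1 e))
  rcases ha.le_iff.1 (inf_le_right : x ⊓ a ≤ a) with ea | ea
  · rcases hb.le_iff.1 (inf_le_right : x ⊓ b ≤ b) with eb | eb
    · by_cases hx : x = ⊥
      · exact Or.inl hx
      · exfalso
        refine hc x (IsCompl.of_eq ea ?_) (IsCompl.of_eq eb ?_)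
        · refine (above hab hb (le_sup_right : a ≤ x ⊔ a)).resolve_left fun e => hx ?_
          rwa [inf_eq_left.2 (sup_eq_right.1 e)] at ea
        · refine (above hab.symm ha (le_sup_right : b ≤ x ⊔ b)).resolve_left fun e => hx ?_
          rwa [inf_eq_left.2 (sup_eq_right.1 e)] at eb
    · rcases above hab.symm ha (inf_eq_right.1 eb) with e | e <;> simp [e]
  · rcases above hab hb (inf_eq_right.1 ea) with e | e <;> simp [e]

/-- Complementary elements `a, b ≠ ⊥` such that `⊥, a, b, ⊤` exhaust the lattice make it the
diamond. -/
theorem IsCompl.exists_orderIso_bool_prod {L : Type*} [Lattice L] [BoundedOrder L]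
    {a b : L} (hab : IsCompl a b) (ha : a ≠ ⊥) (hb : b ≠ ⊥)
    (hall : ∀ x, x = ⊥ ∨ x = a ∨ x = b ∨ x = ⊤) :
    ∃ e : Bool × Bool ≃o L, e (false, false) = ⊥ ∧ e (true, false) = a ∧
      e (false, true) = b ∧ e (true, true) = ⊤ := by
  have hba : ¬ a ≤ b := fun hle => ha (hab.disjoint.eq_bot_of_le hle)
  have hab' : ¬ b ≤ a := fun hle => hb (hab.symm.disjoint.eq_bot_of_le hle)
  have ta : ¬ (⊤ : L) ≤ a := fun hle => hab' (le_top.trans hle)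
  have tb : ¬ (⊤ : L) ≤ b := fun hle => hba (le_top.trans hle)
  have tbot : ¬ (⊤ : L) ≤ ⊥ := fun hle => ta (hle.trans bot_le)
  let f : Bool × Bool → L := fun p => cond p.1 (cond p.2 ⊤ a) (cond p.2 b ⊥)
  have hf : ∀ p p', f p ≤ f p' ↔ p ≤ p' := by
    rintro ⟨_ | _, _ | _⟩ ⟨_ | _, _ | _⟩ <;> simp_all [f]
  refine ⟨RelIso.ofSurjective (OrderEmbedding.ofMapLEIff f hf) ?_, rfl, rfl, rfl, rfl⟩
  intro x
  rcases hall x with rfl | rfl | rfl | rfl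
  exacts [⟨(false, false), rfl⟩, ⟨(true, false), rfl⟩, ⟨(false, true), rfl⟩, ⟨(true, true), rfl⟩]

namespace DahaAW

section Eigenspaces

variable {F : Type*} [Field F] {q : F} {d : ℕ} {k₀ k₁ k₂ k₃ θ : F}
  (h : EParam q d k₀ k₁ k₂ k₃)

theorem EParam.k₀_ne_inv (h : EParam q d k₀ k₁ k₂ k₃) : k₀ ≠ k₀⁻¹ := by
  intro e
  have h0 := h.k₀_ne
  have hs : k₀ ^ 2 = 1 := by
    rw [pow_two]
    nth_rewrite 2 [e]
    exact mul_inv_cancel₀ h0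
  have := h.k₀_sq'
  rw [hs, one_mul] at this
  exact h.generic.pow_ne_one _ d.succ_pos this

theorem t0_smul_sub_mem_eigen (hθ : θ ≠ 0) (hc : k₀ + k₀⁻¹ = θ + θ⁻¹) (x : E h) :
    t q 0 • x - θ⁻¹ • x ∈ eigen h θ := by
  have e : t q 0 • t q 0 • x = (θ + θ⁻¹) • t q 0 • x - x := by
    have := tinv_smul h 0 (t q 0 • x)
    rw [← mul_smul, tinv_mul_t, one_smul, Matrix.cons_val_zero, hc] at this
    rw [eq_sub_iff_add_eq, ← eq_sub_iff_add_eq', ← this]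
  rw [mem_eigen, smul_sub, e, smul_comm (t q 0) θ⁻¹ x]
  generalize t q 0 • x = y
  match_scalars <;> field_simp
  ring

theorem isCompl_eigen : IsCompl (eigen h k₀) (eigen h k₀⁻¹) := by
  have hne := sub_ne_zero.2 h.k₀_ne_inv
  refine IsCompl.of_eq ?_ ?_
  · rw [Submodule.eq_bot_iff]
    rintro x ⟨hx, hx'⟩
    have e : (k₀ - k₀⁻¹) • x = 0 := by
      rw [sub_smul, ← (mem_eigen h).1 hx, ← (mem_eigen h).1 hx', sub_self]
    exact (smul_eq_zero.1 e).resolve_left hne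
  · rw [Submodule.eq_top_iff']
    intro x
    have hx := t0_smul_sub_mem_eigen h h.k₀_ne rfl x
    have hx' := t0_smul_sub_mem_eigen h (inv_ne_zero h.k₀_ne)
      (by rw [inv_inv, add_comm]) x
    have e : x = (k₀ - k₀⁻¹)⁻¹ • (t q 0 • x - k₀⁻¹ • x) +
        -(k₀ - k₀⁻¹)⁻¹ • (t q 0 • x - k₀⁻¹⁻¹ • x) := by
      rw [neg_smul, ← sub_eq_add_neg, ← smul_sub, sub_sub_sub_cancel_left, ← sub_smul, inv_inv,
        smul_smul, inv_mul_cancel₀ hne, one_smul]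
    rw [e]
    exact Submodule.add_mem_sup (Submodule.smul_of_tower_mem _ _ hx)
      (Submodule.smul_of_tower_mem _ _ hx')

/-- The basis vector `vᵢ` as an element of `E(k₀,k₁,k₂,k₃)`. -/
def basisVec (i : ℕ) : E h := v F d i

theorem eq_top_of_basisVec_mem {U : Submodule F (E h)} (hU : ∀ i ≤ d, basisVec h i ∈ U) :
    U = ⊤ := by
  have hb : ∀ i : Fin (d + 1), Pi.basisFun F (Fin (d + 1)) i = v F d i := by
    intro i; ext j; simp [v, Pi.single_apply, Fin.ext_iff]
  rw [eq_top_iff]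
  refine ((Pi.basisFun F (Fin (d + 1))).span_eq.ge : (⊤ : Submodule F (Fin (d + 1) → F)) ≤ _).trans
    (Submodule.span_le.2 ?_)
  rintro _ ⟨i, rfl⟩
  rw [hb]
  exact hU i (by omega)

theorem t0_smul_basisVec_zero : t q 0 • basisVec h 0 = k₀ • basisVec h 0 := by
  rw [t_smul]
  exact t₀_zero

theorem t0_smul_basisVec_odd {m : ℕ} (hm : 2 * m + 1 ≤ d) :
    t q 0 • basisVec h (2 * m + 1) =
      (k₀⁻¹ * (q ^ (2 * m + 2))⁻¹) • (basisVec h (2 * m + 1) - basisVec h (2 * m + 2)) := by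
  rw [t_smul]
  exact t₀_odd h hm

theorem t0_smul_basisVec_last : t q 0 • basisVec h d = k₀ • basisVec h d := by
  rw [t_smul]
  have hd : d ≠ 0 := h.odd.pos.ne'
  exact (endo_v _ le_rfl).trans (by rw [t₀v, if_neg hd, if_pos rfl]; rfl)

theorem basisVec_ne_zero {i : ℕ} (hi : i ≤ d) : basisVec h i ≠ 0 := fun e => by
  have := congrFun (show v F d i = 0 from e) ⟨i, by omega⟩
  simp [v] at this

theorem eigen_ne_bot : eigen h k₀ ≠ ⊥ := fun e =>
  basisVec_ne_zero h d.zero_le <|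
    (Submodule.eq_bot_iff _).1 e _ ((mem_eigen h).2 (t0_smul_basisVec_zero h))

theorem eigen_inv_ne_bot (hd : 3 ≤ d) : eigen h k₀⁻¹ ≠ ⊥ := fun e => by
  have e1 := (Submodule.eq_bot_iff _).1 e _ (t0_smul_sub_mem_eigen h (inv_ne_zero h.k₀_ne)
    (by rw [inv_inv, add_comm]) (basisVec h 1))
  rw [t0_smul_basisVec_odd h (m := 0) (by omega), sub_eq_zero] at e1
  have := congrFun (show (k₀⁻¹ * (q ^ (2 * 0 + 2))⁻¹) • (v F d (2 * 0 + 1) - v F d (2 * 0 + 2)) =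
    k₀⁻¹⁻¹ • v F d 1 from e1) ⟨2, by omega⟩
  simp [v, h.k₀_ne, h.generic.ne_zero] at this

theorem eigen_eq_top (hd : d = 1) : eigen h k₀ = ⊤ := by
  have : (eigen h k₀).restrictScalars F = ⊤ := by
    refine eq_top_of_basisVec_mem h fun i hi => ?_
    rcases Nat.eq_zero_or_pos i with rfl | hi'
    · exact t0_smul_basisVec_zero h
    · obtain rfl : i = d := by omega
      exact t0_smul_basisVec_last h
  exact (Submodule.restrictScalars_eq_top_iff F _ _).1 this

instance : Module.Finite F (E h) := inferInstanceAs (Module.Finite F (Fin (d + 1) → F))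

theorem finrank_E : Module.finrank F (E h) = d + 1 :=
  (Module.finrank_fin_fun F : Module.finrank F (Fin (d + 1) → F) = d + 1)

/-- The `k₀`-eigenspace of `t₀` and the vectors `v₁, v₃, …, v_{d-2}` span `E`. -/
theorem eigen_sup_span_odd :
    (eigen h k₀).restrictScalars F ⊔
      Submodule.span F (Set.range fun m : Fin (d / 2) => basisVec h (2 * m + 1)) = ⊤ := by
  have hq := h.generic.ne_zero
  have hk := h.k₀_ne
  have ho := h.odd
  set S := Submodule.span F (Set.range fun m : Fin (d / 2) => basisVec h (2 * m + 1))
  have hodd (m : ℕ) (hm : 2 * m + 1 < d) : basisVec h (2 * m + 1) ∈ S :=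
    Submodule.subset_span ⟨⟨m, by omega⟩, rfl⟩
  have hP {x : E h} (hx : x ∈ eigen h k₀) : x ∈ (eigen h k₀).restrictScalars F ⊔ S :=
    Submodule.mem_sup_left hx
  refine eq_top_of_basisVec_mem h fun i hi => ?_
  rcases eq_or_ne i d with rfl | hne
  · exact hP (t0_smul_basisVec_last h)
  obtain ⟨m, rfl | rfl⟩ := Nat.even_or_odd' i
  · rcases m with _ | m
    · exact hP (t0_smul_basisVec_zero h)
    · have hm : 2 * m + 1 < d := by omega
      have e := hP (t0_smul_sub_mem_eigen h hk rfl (basisVec h (2 * m + 1)))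
      have hv := Submodule.mem_sup_right (S := (eigen h k₀).restrictScalars F) (hodd m hm)
      rw [Submodule.sub_mem_iff_left _ (Submodule.smul_mem _ _ hv),
        t0_smul_basisVec_odd h hm.le, Submodule.smul_mem_iff _
          (mul_ne_zero (inv_ne_zero hk) (inv_ne_zero (pow_ne_zero _ hq))),
        Submodule.sub_mem_iff_right _ hv] at e
      exact e
  · exact Submodule.mem_sup_right (hodd m (by omega))

theorem finrank_add_of_isCompl {X Y : Submodule (AW q) (E h)} (hXY : IsCompl X Y) :
    Module.finrank F (X.restrictScalars F) + Module.finrank F (Y.restrictScalars F) = d + 1 := by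
  rw [← finrank_E h]
  refine Submodule.finrank_add_eq_of_isCompl (IsCompl.of_eq ?_ ?_)
  · rw [← Submodule.restrictScalars_inf, hXY.inf_eq_bot, Submodule.restrictScalars_bot]
  · rw [← Submodule.restrictScalars_sup, hXY.sup_eq_top, Submodule.restrictScalars_top]

theorem lt_finrank_eigen :
    d + 1 < 2 * Module.finrank F ((eigen h k₀).restrictScalars F) := by
  have h1 := Submodule.finrank_add_le_finrank_add_finrank ((eigen h k₀).restrictScalars F)
    (Submodule.span F (Set.range fun m : Fin (d / 2) => basisVec h (2 * m + 1)))
  have h2 := finrank_range_le_card (R := F) fun m : Fin (d / 2) => basisVec h (2 * m + 1)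
  rw [eigen_sup_span_odd, finrank_top, finrank_E] at h1
  rw [Set.finrank, Fintype.card_fin] at h2
  have ho := h.odd
  obtain ⟨m, hm⟩ := ho
  omega

end Eigenspaces

end DahaAW

open DahaAW

/-- The lattice of `△_q`-submodules of an irreducible `ℌ_q`-module `E(k₀,k₁,k₂,k₃)`. The diamond is
expressed by an isomorphism of lattices with `{0,1} × {0,1}`. -/
theorem mainTheorem4 {F : Type*} [Field F] [IsAlgClosed F] (q : F) (d : ℕ) (k₀ k₁ k₂ k₃ : F)
    (h : EParam q d k₀ k₁ k₂ k₃) (hirr : IsSimpleModule (DAHA q) (E h)) :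
    (d = 1 → IsSimpleModule (AW q) (E h)) ∧
    (3 ≤ d → ∃ e : Bool × Bool ≃o Submodule (AW q) (E h),
      e (false, false) = ⊥ ∧ e (true, false) = eigen h k₀ ∧
      e (false, true) = eigen h k₀⁻¹ ∧ e (true, true) = ⊤) := by
  have hP := isAtom_eigen hirr h.k₀_ne h.k₀_ne_inv rfl (eigen_ne_bot h)
  refine ⟨fun hd => ?_, fun hd => ?_⟩
  · rw [eigen_eq_top h hd] at hP
    exact (isSimpleModule_iff (AW q) (E h)).2 (isSimpleOrder_iff_isAtom_top.2 hP)
  · have hne := eigen_inv_ne_bot h hd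
    have hQ := isAtom_eigen hirr (inv_ne_zero h.k₀_ne)
      (by rw [inv_inv]; exact h.k₀_ne_inv.symm) (by rw [inv_inv, add_comm]) hne
    have hPQ := isCompl_eigen h
    refine hPQ.exists_orderIso_bool_prod hP.1 hne
      (hPQ.eq_of_isAtom_isAtom hP hQ fun X hXP hXQ => ?_)
    have := lt_finrank_eigen h
    have := finrank_add_of_isCompl h hXP
    have := finrank_add_of_isCompl h hXQ
    have := finrank_add_of_isCompl h hPQ
    omega
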